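/- Let $T$ be a finite tree with vertex set $V$, and let $D(T)$ be its distance matrix, i.e. the real symmetric matrix indexed by $V$ whose $(u,v)$-entry is the length of a shortest path from $u$ to $v$ in $T$. Then $D(T)$ has exactly three distinct eigenvalues if and only if $T$ is a star with at least three vertices, i.e. $|V|\ge 3$ and there is a vertex $r$ such that the edges of $T$ are exactly the pairs $\{r,v\}$ with $v\in V\setminus\{r\}$. -/

import Mathlib

/-- The distance matrix of a graph: the real matrix whose `(u, v)` entry is the length of a
shortest path from `u` to `v`. -/
noncomputable def distanceMatrix {V : Type*} (G : SimpleGraph V) : Matrix V V ℝ :=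
  Matrix.of fun u v => (G.dist u v : ℝ)

/-- The set of (distinct) distance eigenvalues of a finite graph: the real eigenvalues of its
distance matrix. As this matrix is real symmetric, these are all of its eigenvalues. -/
def distanceEigenvalues {V : Type*} [Fintype V] [DecidableEq V] (G : SimpleGraph V) : Set ℝ :=
  {μ : ℝ | Module.End.HasEigenvalue (Matrix.toLin' (distanceMatrix G)) μ}

/-- A star: some vertex (the centre) is adjacent to all other vertices, and there are no other
edges. -/
def IsStar {V : Type*} (G : SimpleGraph V) : Prop :=
  ∃ r : V, G = SimpleGraph.starGraph r

open Matrix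

/-! ### Distances in a tree and the inverse of the distance matrix -/

namespace SimpleGraph

variable {V : Type*} {G : SimpleGraph V}

/-! With `L` the Laplacian and `τ = 2 - deg`, the distance matrix `D` of a nontrivial tree has
inverse `-L/2 + ττᵀ/∑ deg` (`IsTree.distanceMatrix_mul_inverse`). As `L` is positive semidefinite
and `D` has trace zero, `D` has exactly one positive eigenvalue, and it is simple. If the other
eigenvalues take only two values `p, q < 0`, then `D - (p + q) + pq D⁻¹` vanishes off one
eigenvector, so it equals `vvᵀ`. Its entries involve only distances, adjacency and degrees;
`IsTree.isStar_of_rank_one_entries` shows that they contradict rank one when the diameter is at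
least 3.

Conversely, the eigenvalues of a star are `-2` and the two roots of an explicit quadratic
(`mem_distanceEigenvalues_starGraph_iff`). -/

theorem IsTree.existsUnique_adj_dist_add_one (hG : G.IsTree) {u w : V} (huw : u ≠ w) :
    ∃! p, G.Adj w p ∧ G.dist u w = G.dist u p + 1 := by
  have key : ∀ p, G.Adj w p → G.dist u w = G.dist u p + 1 →
      ∃ q : G.Walk u w, q.IsPath ∧ q.penultimate = p := by
    intro p hp hd
    obtain ⟨q, hq⟩ := hG.connected.exists_walk_length_eq_dist u p
    refine ⟨q.concat hp.symm, Walk.isPath_of_length_eq_dist _ ?_, by simp⟩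
    rw [Walk.length_concat, hq, hd]
  obtain ⟨q, hqp, hq⟩ := hG.connected.exists_path_of_dist u w
  have hnil : ¬ q.Nil := Walk.not_nil_of_ne huw
  have hadj := (q.adj_penultimate hnil).symm
  refine ⟨q.penultimate, ⟨hadj, ?_⟩, ?_⟩
  · rcases hG.dist_eq_dist_add_one_of_adj u hadj with h | h
    · exact h
    · have h1 := dist_le q.dropLast
      have h2 : q.dropLast.length = q.length - 1 := by simp
      omega
  · rintro p ⟨hp, hd⟩
    obtain ⟨r, hr, rfl⟩ := key p hp hd
    rw [(hG.existsUnique_path u w).unique hr hqp]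

theorem IsTree.dist_eq_add_one_of_adj_of_ne (hG : G.IsTree) {u w p z : V} (hp : G.Adj w p)
    (hd : G.dist u w = G.dist u p + 1) (hz : G.Adj w z) (hzp : z ≠ p) :
    G.dist u z = G.dist u w + 1 := by
  rcases hG.dist_eq_dist_add_one_of_adj u hz with h | h
  · have huw : u ≠ w := by rintro rfl; simp at hd
    exact absurd ((hG.existsUnique_adj_dist_add_one huw).unique ⟨hz, h⟩ ⟨hp, hd⟩) hzp
  · exact h

theorem isHermitian_distanceMatrix (G : SimpleGraph V) : (distanceMatrix G).IsHermitian := by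
  ext u w
  simp [distanceMatrix, dist_comm]

variable [Fintype V] [DecidableEq V] [DecidableRel G.Adj]

/-- Exactly one neighbour of `w` is closer to `u`; all others are farther. Taking `g` to be the
identity and the square gives the Laplacian of the distance and of its square. -/
theorem IsTree.sum_neighborFinset_dist (hG : G.IsTree) (g : ℕ → ℝ) {u w : V} {k : ℕ}
    (hk : G.dist u w = k + 1) :
    ∑ z ∈ G.neighborFinset w, g (G.dist u z) = g k + (G.degree w - 1) * g (k + 2) := by
  have huw : u ≠ w := by rintro rfl; simp at hk
  obtain ⟨p, ⟨hp, hd⟩, -⟩ := hG.existsUnique_adj_dist_add_one huw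
  have hmem : p ∈ G.neighborFinset w := by simpa using hp
  rw [← Finset.add_sum_erase _ _ hmem]
  have hrest : ∀ z ∈ (G.neighborFinset w).erase p, g (G.dist u z) = g (k + 2) := by
    intro z hz
    rw [Finset.mem_erase, mem_neighborFinset] at hz
    rw [hG.dist_eq_add_one_of_adj_of_ne hp hd hz.2 hz.1, hk]
  rw [Finset.sum_congr rfl hrest, Finset.sum_const, Finset.card_erase_of_mem hmem,
    card_neighborFinset_eq_degree, nsmul_eq_mul, Nat.cast_sub, Nat.cast_one,
    show G.dist u p = k by omega]
  rw [← card_neighborFinset_eq_degree]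
  exact Finset.card_pos.mpr ⟨p, hmem⟩

theorem sum_lapMatrix_mulVec (f : V → ℝ) : ∑ w, (G.lapMatrix ℝ *ᵥ f) w = 0 := by
  have h : (fun _ => 1) ⬝ᵥ (G.lapMatrix ℝ *ᵥ f) = 0 := by
    rw [dotProduct_mulVec, ← mulVec_transpose, (G.isSymm_lapMatrix (R := ℝ)).eq,
      lapMatrix_mulVec_const_eq_zero, zero_dotProduct]
  simpa [dotProduct] using h

theorem IsTree.lapMatrix_mulVec_dist (hG : G.IsTree) (u w : V) :
    (G.lapMatrix ℝ *ᵥ fun z => (G.dist u z : ℝ)) w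
      = 2 - G.degree w - 2 * (1 : Matrix V V ℝ) u w := by
  rw [lapMatrix_mulVec_apply]
  by_cases huw : u = w
  · subst huw
    have : ∀ z ∈ G.neighborFinset u, (G.dist u z : ℝ) = 1 := by
      intro z hz
      rw [mem_neighborFinset, ← dist_eq_one_iff_adj] at hz
      simp [hz]
    rw [Finset.sum_congr rfl this]
    simp
  · obtain ⟨k, hk⟩ := Nat.exists_eq_succ_of_ne_zero
      ((hG.connected.dist_eq_zero_iff (u := u) (v := w)).not.mpr huw)
    rw [hG.sum_neighborFinset_dist (fun n => (n : ℝ)) hk, hk, one_apply_ne huw]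
    push_cast
    ring

theorem IsTree.lapMatrix_mulVec_dist_sq (hG : G.IsTree) (u w : V) :
    (G.lapMatrix ℝ *ᵥ fun z => (G.dist u z : ℝ) ^ 2) w
      = 2 * (G.dist u w * (2 - G.degree w)) - G.degree w := by
  rw [lapMatrix_mulVec_apply]
  by_cases huw : u = w
  · subst huw
    have : ∀ z ∈ G.neighborFinset u, (G.dist u z : ℝ) ^ 2 = 1 := by
      intro z hz
      rw [mem_neighborFinset, ← dist_eq_one_iff_adj] at hz
      simp [hz]
    rw [Finset.sum_congr rfl this]
    simp
  · obtain ⟨k, hk⟩ := Nat.exists_eq_succ_of_ne_zero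
      ((hG.connected.dist_eq_zero_iff (u := u) (v := w)).not.mpr huw)
    rw [hG.sum_neighborFinset_dist (fun n => (n : ℝ) ^ 2) hk, hk]
    push_cast
    ring

theorem IsTree.distanceMatrix_mul_lapMatrix (hG : G.IsTree) :
    distanceMatrix G * G.lapMatrix ℝ
      = vecMulVec (fun _ => 1) (fun w => 2 - (G.degree w : ℝ)) - (2 : ℝ) • 1 := by
  ext u w
  have h := hG.lapMatrix_mulVec_dist u w
  rw [← (G.isSymm_lapMatrix (R := ℝ)).eq, mulVec_transpose] at h
  simpa [mul_apply, vecMul, dotProduct, distanceMatrix, vecMulVec_apply] using h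

theorem IsTree.distanceMatrix_mulVec_two_sub_degree (hG : G.IsTree) :
    distanceMatrix G *ᵥ (fun w => 2 - (G.degree w : ℝ))
      = fun _ => (∑ w, (G.degree w : ℝ)) / 2 := by
  ext u
  -- The Laplacian of any function sums to zero; for the squared distance this sum is twice the
  -- wanted entry minus the degree sum.
  have h := sum_lapMatrix_mulVec (G := G) fun z => (G.dist u z : ℝ) ^ 2
  simp_rw [hG.lapMatrix_mulVec_dist_sq] at h
  rw [Finset.sum_sub_distrib, ← Finset.mul_sum] at h
  simp only [mulVec, dotProduct, distanceMatrix, of_apply]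
  linarith

/-- The Graham–Lovász formula for the inverse of the distance matrix of a tree. -/
theorem IsTree.distanceMatrix_mul_inverse (hG : G.IsTree) (hs : ∑ w, (G.degree w : ℝ) ≠ 0) :
    distanceMatrix G * (-((1 / 2 : ℝ) • G.lapMatrix ℝ) + (∑ w, (G.degree w : ℝ))⁻¹ •
      vecMulVec (fun w => 2 - (G.degree w : ℝ)) (fun w => 2 - (G.degree w : ℝ))) = 1 := by
  rw [mul_add, mul_neg, Matrix.mul_smul, Matrix.mul_smul, mul_vecMulVec,
    hG.distanceMatrix_mul_lapMatrix, hG.distanceMatrix_mulVec_two_sub_degree]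
  ext u w
  simp [vecMulVec_apply]
  field_simp
  ring

end SimpleGraph

/-! ### Spectral consequences of the form of the inverse -/

namespace Matrix.IsHermitian

variable {n : Type*} [Fintype n] [DecidableEq n] {A : Matrix n n ℝ}

theorem sum_vecMulVec_eigenvectorBasis (hA : A.IsHermitian) :
    ∑ i, vecMulVec (hA.eigenvectorBasis i).ofLp (hA.eigenvectorBasis i).ofLp = 1 := by
  have h := Unitary.coe_mul_star_self hA.eigenvectorUnitary
  rw [← h]
  ext u w
  simp [Matrix.sum_apply, vecMulVec_apply, mul_apply, star_apply]

theorem eq_sum_smul_vecMulVec_of_mulVec_eigenvectorBasis (hA : A.IsHermitian) {B : Matrix n n ℝ}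
    {f : n → ℝ}
    (hB : ∀ i, B *ᵥ (hA.eigenvectorBasis i).ofLp = f i • (hA.eigenvectorBasis i).ofLp) :
    B = ∑ i, f i • vecMulVec (hA.eigenvectorBasis i).ofLp (hA.eigenvectorBasis i).ofLp := by
  conv_lhs => rw [← mul_one B, ← hA.sum_vecMulVec_eigenvectorBasis, Finset.mul_sum]
  simp_rw [mul_vecMulVec, hB, smul_vecMulVec]

theorem eigenvectorBasis_dotProduct (hA : A.IsHermitian) (i j : n) :
    (hA.eigenvectorBasis i).ofLp ⬝ᵥ (hA.eigenvectorBasis j).ofLp = if i = j then 1 else 0 := by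
  have h := orthonormal_iff_ite.mp hA.eigenvectorBasis.orthonormal j i
  rw [EuclideanSpace.inner_eq_star_dotProduct] at h
  simpa [eq_comm] using h

theorem eigenvalues_ne_zero_of_mul_eq_one (hA : A.IsHermitian) {N : Matrix n n ℝ}
    (hN : A * N = 1) (i : n) : hA.eigenvalues i ≠ 0 := by
  intro h0
  have h := hA.mulVec_eigenvectorBasis i
  rw [h0, zero_smul] at h
  have h1 : (hA.eigenvectorBasis i).ofLp = 0 := by
    rw [← one_mulVec (hA.eigenvectorBasis i).ofLp, ← mul_eq_one_comm.mp hN, ← mulVec_mulVec, h,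
      mulVec_zero]
  simpa [h1] using hA.eigenvectorBasis_dotProduct i i

theorem mulVec_eigenvectorBasis_of_mul_eq_one (hA : A.IsHermitian) {N : Matrix n n ℝ}
    (hN : A * N = 1) (i : n) :
    N *ᵥ (hA.eigenvectorBasis i).ofLp
      = (hA.eigenvalues i)⁻¹ • (hA.eigenvectorBasis i).ofLp := by
  have h0 := hA.eigenvalues_ne_zero_of_mul_eq_one hN i
  have h : (hA.eigenvectorBasis i).ofLp
      = (hA.eigenvalues i)⁻¹ • A *ᵥ (hA.eigenvectorBasis i).ofLp := by
    rw [hA.mulVec_eigenvectorBasis, inv_smul_smul₀ h0]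
  conv_lhs => rw [h, mulVec_smul, mulVec_mulVec, mul_eq_one_comm.mp hN, one_mulVec]

/-- A matrix whose inverse is a rank one perturbation of a negative semidefinite matrix has at most
one positive eigenvalue. -/
theorem eq_of_eigenvalues_pos (hA : A.IsHermitian) {P : Matrix n n ℝ} (hP : P.PosSemidef)
    {c : ℝ} {t : n → ℝ} (hN : A * (-P + c • vecMulVec t t) = 1) {i j : n}
    (hi : 0 < hA.eigenvalues i) (hj : 0 < hA.eigenvalues j) : i = j := by
  by_contra hij
  set N := -P + c • vecMulVec t t with hNdef
  set x := (hA.eigenvectorBasis i).ofLp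
  set y := (hA.eigenvectorBasis j).ofLp
  have hx : N *ᵥ x = (hA.eigenvalues i)⁻¹ • x := hA.mulVec_eigenvectorBasis_of_mul_eq_one hN i
  have hy : N *ᵥ y = (hA.eigenvalues j)⁻¹ • y := hA.mulVec_eigenvectorBasis_of_mul_eq_one hN j
  have hxx : x ⬝ᵥ x = 1 := by simpa using hA.eigenvectorBasis_dotProduct i i
  have hyy : y ⬝ᵥ y = 1 := by simpa using hA.eigenvectorBasis_dotProduct j j
  have hxy : x ⬝ᵥ y = 0 := by simpa [hij] using hA.eigenvectorBasis_dotProduct i j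
  have hyx : y ⬝ᵥ x = 0 := by rw [dotProduct_comm, hxy]
  have hneg : ∀ z : n → ℝ, t ⬝ᵥ z = 0 → z ⬝ᵥ N *ᵥ z ≤ 0 := by
    intro z hz
    have h := hP.dotProduct_mulVec_nonneg z
    rw [star_trivial] at h
    rw [hNdef, add_mulVec, neg_mulVec, smul_mulVec, vecMulVec_mulVec, hz]
    simpa using h
  have hxpos := inv_pos.mpr hi
  have hypos := inv_pos.mpr hj
  -- This vector is orthogonal to `t`, yet the form takes the value `(t·y)²/λᵢ + (t·x)²/λⱼ` on it.
  -- Hence `t·x = 0`, and then `x` itself violates `hneg`.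
  have h := hneg ((t ⬝ᵥ y) • x - (t ⬝ᵥ x) • y) (by
    simp only [dotProduct_sub, dotProduct_smul, smul_eq_mul]; ring)
  simp only [mulVec_sub, mulVec_smul, hx, hy, dotProduct_sub, sub_dotProduct, smul_dotProduct,
    dotProduct_smul, hxx, hyy, hxy, hyx, smul_eq_mul] at h
  have htx : t ⬝ᵥ x = 0 := by
    by_contra hne
    have := mul_pos (pow_pos (abs_pos.mpr hne) 2) hypos
    rw [sq_abs] at this
    have := mul_nonneg (sq_nonneg (t ⬝ᵥ y)) hxpos.le
    nlinarith
  have h' := hneg x htx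
  rw [hx, dotProduct_smul, hxx, smul_eq_mul, mul_one] at h'
  linarith

/-- If a trace zero matrix with three distinct eigenvalues has an inverse `N` that is a rank one
perturbation of a negative semidefinite matrix, then some combination of it with the identity and
`N` is positive semidefinite of rank one. -/
theorem exists_add_smul_one_add_smul_eq_vecMulVec (hA : A.IsHermitian) (htr : A.trace = 0)
    {P : Matrix n n ℝ} (hP : P.PosSemidef) {c : ℝ} {t : n → ℝ}
    (hN : A * (-P + c • vecMulVec t t) = 1)
    (hcard : (Set.range hA.eigenvalues).ncard = 3) :
    ∃ a b : ℝ, ∃ v : n → ℝ, 0 < b ∧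
      A + a • 1 + b • (-P + c • vecMulVec t t) = vecMulVec v v := by
  have hne := hA.eigenvalues_ne_zero_of_mul_eq_one hN
  obtain ⟨i₀, hi₀⟩ : ∃ i, 0 < hA.eigenvalues i := by
    by_contra! hle
    have hsum : ∑ i, hA.eigenvalues i = 0 := by
      rw [← htr, hA.trace_eq_sum_eigenvalues]; simp
    have hzero := (Finset.sum_eq_zero_iff_of_nonpos fun i _ => hle i).mp hsum
    obtain ⟨_, i, rfl⟩ := Set.nonempty_of_ncard_ne_zero (by rw [hcard]; norm_num)
    exact hne i (hzero i (Finset.mem_univ i))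
  have hlt : ∀ i, i ≠ i₀ → hA.eigenvalues i < 0 := fun i hi =>
    lt_of_le_of_ne (not_lt.mp fun h => hi (hA.eq_of_eigenvalues_pos hP hN h hi₀)) (hne i)
  have hcard' : (Set.range hA.eigenvalues \ {hA.eigenvalues i₀}).ncard = 2 := by
    rw [Set.ncard_sdiff_singleton_of_mem (Set.mem_range_self i₀), hcard]
  obtain ⟨p, q, -, hpq⟩ := Set.ncard_eq_two.mp hcard'
  have hneg : ∀ r ∈ Set.range hA.eigenvalues \ {hA.eigenvalues i₀}, r < 0 := by
    rintro _ ⟨⟨i, rfl⟩, hi⟩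
    exact hlt i fun h => hi (by simp [h])
  have hp : p < 0 := hneg p (by simp [hpq])
  have hq : q < 0 := hneg q (by simp [hpq])
  have hor : ∀ i, i ≠ i₀ → hA.eigenvalues i = p ∨ hA.eigenvalues i = q := by
    intro i hi
    have : hA.eigenvalues i ∈ Set.range hA.eigenvalues \ {hA.eigenvalues i₀} :=
      ⟨⟨i, rfl⟩, fun h => by
        have h1 := hlt i hi
        rw [Set.mem_singleton_iff.mp h] at h1
        exact lt_asymm h1 hi₀⟩
    simpa [hpq] using this
  -- `f i = (λᵢ - p)(λᵢ - q)/λᵢ`, which vanishes at `p` and `q` and is positive at the positive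
  -- eigenvalue.
  set f : n → ℝ := fun i => hA.eigenvalues i - (p + q) + p * q * (hA.eigenvalues i)⁻¹ with hf
  have hf0 : ∀ i, i ≠ i₀ → f i = 0 := by
    intro i hi
    simp only [hf]
    rcases hor i hi with h | h <;> rw [h] <;> field_simp [hp.ne, hq.ne] <;> ring
  have hfpos : 0 ≤ f i₀ := by
    have := mul_pos (mul_pos_of_neg_of_neg hp hq) (inv_pos.mpr hi₀)
    simp only [hf]
    linarith
  refine ⟨-(p + q), p * q, √(f i₀) • (hA.eigenvectorBasis i₀).ofLp,
    mul_pos_of_neg_of_neg hp hq, ?_⟩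
  rw [hA.eq_sum_smul_vecMulVec_of_mulVec_eigenvectorBasis (f := f)
    (B := A + (-(p + q)) • 1 + (p * q) • (-P + c • vecMulVec t t)), Finset.sum_eq_single i₀]
  · rw [smul_vecMulVec, vecMulVec_smul, smul_smul, Real.mul_self_sqrt hfpos]
  · intro i _ hi
    rw [hf0 i hi, zero_smul]
  · simp
  · intro i
    rw [add_mulVec, add_mulVec, smul_mulVec, smul_mulVec, one_mulVec,
      hA.mulVec_eigenvectorBasis_of_mul_eq_one hN, hA.mulVec_eigenvectorBasis, smul_smul,
      ← add_smul, ← add_smul]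
    rfl

end Matrix.IsHermitian

/-! ### From rank one to a star -/

namespace SimpleGraph

variable {V : Type*} {G : SimpleGraph V}

theorem IsTree.eq_starGraph_of_forall_dist_le_one (hG : G.IsTree) {r : V}
    (h : ∀ z, G.dist z r ≤ 1) : G = starGraph r := by
  have hr : ∀ z, z ≠ r → G.Adj z r := fun z hz => by
    rw [← dist_eq_one_iff_adj]
    have := hG.connected.pos_dist_of_ne hz
    have := h z
    omega
  ext a b
  rw [starGraph_adj]
  constructor
  · refine fun hab => ⟨hab.ne, ?_⟩
    by_contra! hne
    have ha := dist_eq_one_iff_adj.mpr (hr a hne.1).symm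
    have hb := dist_eq_one_iff_adj.mpr (hr b hne.2).symm
    exact hG.dist_ne_of_adj r hab (ha.trans hb.symm)
  · rintro ⟨hab, rfl | rfl⟩
    · exact (hr b hab.symm).symm
    · exact hr a hab

variable [Fintype V] [DecidableEq V] [DecidableRel G.Adj]

/-- Every neighbour of `u` except the one towards `w` would be farther from `w` than `u` is. -/
theorem IsTree.degree_eq_one_of_forall_dist_le (hG : G.IsTree) {u w : V} (huw : u ≠ w)
    (h : ∀ z, G.dist w z ≤ G.dist w u) : G.degree u = 1 := by
  rw [degree_eq_one_iff_existsUnique_adj]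
  obtain ⟨p, ⟨hp, hd⟩, -⟩ := hG.existsUnique_adj_dist_add_one huw.symm
  refine ⟨p, hp, fun z hz => ?_⟩
  by_contra hzp
  have := hG.dist_eq_add_one_of_adj_of_ne hp hd hz hzp
  have := h z
  omega

theorem degree_eq_two_of_forall_adj {x p q : V} (hpq : p ≠ q) (hp : G.Adj x p)
    (hq : G.Adj x q) (h : ∀ z, G.Adj x z → z = p ∨ z = q) : G.degree x = 2 := by
  rw [← card_neighborFinset_eq_degree, Finset.card_eq_two]
  refine ⟨p, q, hpq, ?_⟩
  ext z
  simp only [mem_neighborFinset, Finset.mem_insert, Finset.mem_singleton]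
  exact ⟨h z, by rintro (rfl | rfl) <;> assumption⟩

/-- If no two leaves are at distance two, then the neighbour of an endpoint of a longest path
in a tree has degree two. -/
theorem IsTree.degree_eq_two_of_adj_of_forall_dist_le (hG : G.IsTree) {u w x p : V}
    (hleaf : ∀ y z, y ≠ z → G.degree y = 1 → G.degree z = 1 → G.dist y z ≠ 2)
    (hmax : ∀ y, G.dist w y ≤ G.dist w u) (hxu : G.Adj x u) (hdu : G.dist w u = G.dist w x + 1)
    (hxp : G.Adj x p) (hdp : G.dist w x = G.dist w p + 1) : G.degree x = 2 := by
  have hup : u ≠ p := by rintro rfl; omega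
  have huw : u ≠ w := by rintro rfl; simp at hdu
  refine degree_eq_two_of_forall_adj hup hxu hxp fun z hz => ?_
  by_contra! hne
  have hdz := hG.dist_eq_add_one_of_adj_of_ne hxp hdp hz hne.2
  have hzw : z ≠ w := by rintro rfl; simp at hdz
  have hz1 := hG.degree_eq_one_of_forall_dist_le hzw fun y => by
    have := hmax y
    omega
  have hu1 := hG.degree_eq_one_of_forall_dist_le huw hmax
  refine hleaf u z hne.1.symm hu1 hz1 ?_
  have h1 := dist_eq_one_iff_adj.mpr hxu.symm
  have h2 := hG.dist_eq_add_one_of_adj_of_ne (u := u) hxu (by rw [h1, dist_self]) hz hne.1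
  omega

/-- If a combination of the distance matrix of a tree with the identity and the inverse of the
distance matrix has rank one, then the tree is a star. -/
theorem IsTree.isStar_of_rank_one_entries (hG : G.IsTree) [Nontrivial V] {a b c : ℝ} {v : V → ℝ}
    (hb : 0 < b) (hc : 0 < c)
    (hdiag : ∀ u, a - b * G.degree u + c * (2 - G.degree u) ^ 2 = v u * v u)
    (hoff : ∀ u w, u ≠ w → G.dist u w + b * (if G.Adj u w then 1 else 0)
      + c * ((2 - G.degree u) * (2 - G.degree w)) = v u * v w) :
    IsStar G := by
  have heq : ∀ x y, x ≠ y → v x * v x = v y * v y → 0 ≤ v x * v y → v x * v y = v x * v x := by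
    intro x y _ h h0
    rcases mul_self_eq_mul_self_iff.mp h with h | h
    · rw [h]
    · have := mul_self_nonneg (v y)
      rw [h] at h0 ⊢
      nlinarith
  -- Leaves share the same diagonal entry, and `c > 0` makes the entry between two nonadjacent
  -- leaves positive, so `v` agrees on them.
  have hleafdist : ∀ x y, x ≠ y → G.degree x = 1 → G.degree y = 1 → ¬ G.Adj x y →
      (G.dist x y : ℝ) = a - b := by
    intro x y hxy hx hy hadj
    have h1 := hdiag x
    have h2 := hdiag y
    have h3 := hoff x y hxy
    rw [hx] at h1 h3
    rw [hy] at h2 h3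
    have h4 := heq x y hxy (by rw [← h1, ← h2]) (by rw [← h3, if_neg hadj]; norm_num; positivity)
    rw [← h3, ← h1, if_neg hadj] at h4
    push_cast at h4
    linarith
  obtain ⟨⟨u, w⟩, hmax⟩ := Finite.exists_max fun q : V × V => G.dist q.1 q.2
  have hmax : ∀ y z, G.dist y z ≤ G.dist u w := fun y z => hmax (y, z)
  have huw : u ≠ w := by
    rintro rfl
    obtain ⟨y, z, hyz⟩ := exists_pair_ne V
    have := hG.connected.pos_dist_of_ne hyz
    have := hmax y z
    rw [dist_self] at this
    omega
  have hu1 := hG.degree_eq_one_of_forall_dist_le huw fun z => by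
    rw [dist_comm (u := w) (v := u)]; exact hmax w z
  have hw1 := hG.degree_eq_one_of_forall_dist_le huw.symm fun z => hmax u z
  obtain ⟨x, ⟨hux, hwu⟩, -⟩ := hG.existsUnique_adj_dist_add_one huw.symm
  obtain ⟨y, ⟨hwy, huy⟩, -⟩ := hG.existsUnique_adj_dist_add_one huw
  have hfar : ∀ z, z ≠ u → G.dist z u = G.dist z x + 1 := by
    intro z hz
    obtain ⟨q, ⟨hq, hqd⟩, -⟩ := hG.existsUnique_adj_dist_add_one hz
    rwa [(degree_eq_one_iff_existsUnique_adj.mp hu1).unique hux hq]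
  rcases Nat.lt_or_ge (G.dist u w) 3 with hd | hd
  · refine ⟨x, hG.eq_starGraph_of_forall_dist_le_one fun z => ?_⟩
    by_cases hz : z = u
    · rw [hz, dist_eq_one_iff_adj.mpr hux]
    · have := hfar z hz
      have := hmax z u
      omega
  exfalso
  have hnuw : ¬ G.Adj u w := by rw [← dist_eq_one_iff_adj]; omega
  -- All nonadjacent pairs of leaves are at the same distance, namely the diameter, which is now at
  -- least 3.
  have hleaf : ∀ y z, y ≠ z → G.degree y = 1 → G.degree z = 1 → G.dist y z ≠ 2 := by
    intro y z hyz hy hz h2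
    have h3 := (hleafdist y z hyz hy hz (by rw [← dist_eq_one_iff_adj]; omega)).trans (hleafdist u w huw hu1 hw1 hnuw).symm
    have h4 : G.dist y z = G.dist u w := by exact_mod_cast h3
    omega
  rw [dist_comm] at hwu
  have hxw : w ≠ x := by rintro rfl; rw [dist_self] at hwu; omega
  have hyu : u ≠ y := by rintro rfl; rw [dist_self] at huy; omega
  obtain ⟨p, ⟨hxp, hwx⟩, -⟩ := hG.existsUnique_adj_dist_add_one hxw
  obtain ⟨q, ⟨hyq, huyq⟩, -⟩ := hG.existsUnique_adj_dist_add_one hyu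
  have hx2 : G.degree x = 2 := hG.degree_eq_two_of_adj_of_forall_dist_le hleaf
    (fun z => by rw [dist_comm (u := w) (v := u)]; exact hmax w z) hux.symm
    (by rw [dist_comm, hwu]) hxp hwx
  have hy2 : G.degree y = 2 := hG.degree_eq_two_of_adj_of_forall_dist_le hleaf
    (fun z => hmax u z) hwy.symm huy hyq huyq
  have hxydist : G.dist x y + 2 = G.dist u w := by
    have h1 := hfar y hyu.symm
    rw [dist_comm, dist_comm (u := y)] at h1
    omega
  have hxy : x ≠ y := by rintro rfl; simp at hxydist; omega
  have hMuw := hleafdist u w huw hu1 hw1 hnuw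
  have hDu := hdiag u
  have hDx := hdiag x
  have hDy := hdiag y
  have hux' := hoff u x hux.ne
  have hxy' := hoff x y hxy
  have huy' := hoff u y hyu
  have hnuy : ¬ G.Adj u y := by rw [← dist_eq_one_iff_adj]; omega
  rw [hu1] at hDu hux' huy'
  rw [hx2] at hDx hux' hxy'
  rw [hy2] at hDy hxy' huy'
  rw [if_pos hux, dist_eq_one_iff_adj.mpr hux] at hux'
  rw [if_neg hnuy] at huy'
  have hxyx := heq x y hxy (by rw [← hDx, ← hDy])
    (by rw [← hxy']; norm_num; split_ifs <;> positivity)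
  have hmul : (v u * v u) * (v x * v x) = (v u * v x) * (v u * v x) := by ring
  rw [← hxydist] at hMuw
  push_cast at hMuw hDu hDx hux' hxy' huy'
  -- If `x` and `y` are adjacent, the diameter is 3, so `b = 1` and `a = 4`; the principal minor on
  -- `u, x` then forces `c = -1`.
  by_cases hadj : G.Adj x y
  · rw [if_pos hadj] at hxy'
    rw [dist_eq_one_iff_adj.mpr hadj] at hxy' hMuw
    push_cast at hMuw hxy'
    have hb1 : b = 1 := by linarith
    rw [← hDu, ← hDx, ← hux', hb1, show a = 4 by linarith] at hmul
    linarith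
  · rw [if_neg hadj] at hxy'
    have hD2 : 2 ≤ G.dist x y := by
      have := hG.connected.pos_dist_of_ne hxy
      have : G.dist x y ≠ 1 := by rwa [Ne, dist_eq_one_iff_adj]
      omega
    have hD2' : (2 : ℝ) ≤ G.dist x y := by exact_mod_cast hD2
    have hb2 : b = 2 := by linarith
    have hpu : u ≠ p := by
      rintro rfl
      have := dist_comm (G := G) (u := w) (v := u)
      omega
    have hup2 : G.dist u p = 2 := by
      have := hfar p hpu.symm
      rw [dist_comm, this, dist_eq_one_iff_adj.mpr hxp.symm]
    have hup' := hoff u p hpu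
    have hxp' := hoff x p hxp.ne
    have hnup : ¬ G.Adj u p := by rw [← dist_eq_one_iff_adj]; omega
    rw [hup2, hu1, if_neg hnup] at hup'
    rw [dist_eq_one_iff_adj.mpr hxp, hx2, if_pos hxp] at hxp'
    have hp2 : 2 ≤ G.degree p := by
      have h0 : 0 < G.degree p := (degree_pos_iff_exists_adj _ _).mpr ⟨x, hxp.symm⟩
      have h1 : G.degree p ≠ 1 := fun h1 => hleaf u p hpu hu1 h1 hup2
      omega
    have hp2' : (2 : ℝ) ≤ G.degree p := by exact_mod_cast hp2
    -- Minor with rows `u, x` and columns `p, y`: with `d = dist x y` it reads `(2 + c(2 - deg p)) d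
    -- = 3(d + 1)`, impossible as `deg p ≥ 2`.
    have hmul' : (v u * v p) * (v x * v y) = (v x * v p) * (v u * v y) := by ring
    have hduy : G.dist u y = G.dist x y + 1 := by omega
    rw [← hup', ← hxy', ← hxp', ← huy', hb2, hduy] at hmul'
    push_cast at hmul'
    have := mul_nonneg (mul_nonneg hc.le (sub_nonneg.mpr hp2')) (by linarith : (0:ℝ) ≤ G.dist x y)
    nlinarith

theorem setOf_eigenvalues_eq_range {n : Type*} [Fintype n] [DecidableEq n] {A : Matrix n n ℝ}
    (hA : A.IsHermitian) :
    {μ : ℝ | Module.End.HasEigenvalue (toLin' A) μ} = Set.range hA.eigenvalues := by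
  rw [← hA.spectrum_real_eq_range_eigenvalues, ← spectrum_toLin']
  ext μ
  exact Module.End.hasEigenvalue_iff_mem_spectrum

theorem IsTree.isStar_of_ncard_eq_three (hG : G.IsTree)
    (h3 : (distanceEigenvalues G).ncard = 3) : 3 ≤ Fintype.card V ∧ IsStar G := by
  have hA := isHermitian_distanceMatrix G
  rw [distanceEigenvalues, setOf_eigenvalues_eq_range hA] at h3
  have hV : 3 ≤ Fintype.card V := by
    rw [← h3, ← Set.image_univ, Fintype.card_eq_nat_card, ← Set.ncard_univ]
    exact Set.ncard_image_le
  refine ⟨hV, ?_⟩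
  have : Nontrivial V := Fintype.one_lt_card_iff_nontrivial.mp (by omega)
  have hs : 0 < ∑ w, (G.degree w : ℝ) := by
    refine Finset.sum_pos (fun w _ => ?_) Finset.univ_nonempty
    exact_mod_cast hG.connected.preconnected.degree_pos_of_nontrivial w
  have hP : ((1 / 2 : ℝ) • G.lapMatrix ℝ).PosSemidef :=
    (G.posSemidef_lapMatrix ℝ).smul (by norm_num)
  obtain ⟨a, b, v, hb, hM⟩ := hA.exists_add_smul_one_add_smul_eq_vecMulVec
    (by simp [Matrix.trace, distanceMatrix]) hP (hG.distanceMatrix_mul_inverse hs.ne') h3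
  -- `b / 2` absorbs the factor `1/2` on the Laplacian, and `c` the coefficient of `ττᵀ`.
  refine hG.isStar_of_rank_one_entries (a := a) (b := b / 2)
    (c := b * (∑ w, (G.degree w : ℝ))⁻¹) (v := v) (by positivity) (by positivity) ?_ ?_
  · intro u
    have h := congrFun (congrFun hM u) u
    simp [distanceMatrix, lapMatrix, degMatrix, vecMulVec_apply] at h
    rw [← h]
    ring
  · intro u w huw
    have h := congrFun (congrFun hM u) w
    simp [distanceMatrix, lapMatrix, degMatrix, vecMulVec_apply, huw, adjMatrix_apply] at h
    rw [← h]
    split_ifs <;> ring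

end SimpleGraph

/-! ### The distance spectrum of a star -/

namespace SimpleGraph

variable {V : Type*}

theorem dist_starGraph_center {r v : V} (h : r ≠ v) : (starGraph r).dist r v = 1 :=
  dist_eq_one_iff_adj.mpr (starGraph_center_adj h)

theorem dist_starGraph_of_ne {r v w : V} (hv : v ≠ r) (hw : w ≠ r) (hvw : v ≠ w) :
    (starGraph r).dist v w = 2 := by
  have h1 : (starGraph r).dist v w ≤ 2 := by
    have := (connected_starGraph r).dist_triangle (u := v) (v := r) (w := w)
    rw [dist_comm (u := v) (v := r), dist_starGraph_center hv.symm,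
      dist_starGraph_center hw.symm] at this
    exact this
  have h2 := (connected_starGraph r).one_lt_dist_of_ne_of_not_adj hvw (by
    rw [starGraph_adj]; tauto)
  omega

variable [Fintype V] [DecidableEq V]

theorem distanceMatrix_starGraph_mulVec_center (r : V) (x : V → ℝ) :
    (distanceMatrix (starGraph r) *ᵥ x) r = ∑ w ∈ Finset.univ.erase r, x w := by
  simp only [mulVec, dotProduct, distanceMatrix, of_apply]
  rw [← Finset.add_sum_erase _ _ (Finset.mem_univ r), dist_self, Nat.cast_zero, zero_mul, zero_add]
  refine Finset.sum_congr rfl fun w hw => ?_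
  rw [dist_starGraph_center (Finset.ne_of_mem_erase hw).symm, Nat.cast_one, one_mul]

theorem distanceMatrix_starGraph_mulVec_of_ne {r v : V} (hv : v ≠ r) (x : V → ℝ) :
    (distanceMatrix (starGraph r) *ᵥ x) v
      = x r + 2 * (∑ w ∈ Finset.univ.erase r, x w - x v) := by
  simp only [mulVec, dotProduct, distanceMatrix, of_apply]
  have hmem : v ∈ Finset.univ.erase r := by simp [hv]
  rw [← Finset.add_sum_erase _ _ (Finset.mem_univ r), dist_comm, dist_starGraph_center hv.symm,
    ← Finset.add_sum_erase _ _ hmem, ← Finset.add_sum_erase _ x hmem, dist_self,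
    add_sub_cancel_left, Finset.mul_sum, Nat.cast_one, one_mul, Nat.cast_zero, zero_mul, zero_add]
  congr 1
  refine Finset.sum_congr rfl fun w hw => ?_
  simp only [Finset.mem_erase] at hw
  rw [dist_starGraph_of_ne hv hw.2.1 hw.1.symm, Nat.cast_ofNat]

theorem mem_distanceEigenvalues_iff {G : SimpleGraph V} {μ : ℝ} :
    μ ∈ distanceEigenvalues G ↔ ∃ x : V → ℝ, x ≠ 0 ∧ distanceMatrix G *ᵥ x = μ • x := by
  rw [distanceEigenvalues, Set.mem_ofPred_eq, Module.End.HasEigenvalue,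
    Module.End.HasUnifEigenvalue, Submodule.ne_bot_iff]
  simp [and_comm]

theorem mem_distanceEigenvalues_starGraph_iff (hV : 3 ≤ Fintype.card V) (r : V) {μ : ℝ} :
    μ ∈ distanceEigenvalues (starGraph r) ↔
      μ = -2 ∨ μ ^ 2 - 2 * (Fintype.card V - 2) * μ - (Fintype.card V - 1) = 0 := by
  have hcard : ((Finset.univ.erase r).card : ℝ) = Fintype.card V - 1 := by
    rw [Finset.card_erase_of_mem (Finset.mem_univ r), Finset.card_univ, Nat.cast_sub (by omega),
      Nat.cast_one]
  have hV' : (3 : ℝ) ≤ Fintype.card V := by exact_mod_cast hV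
  rw [mem_distanceEigenvalues_iff]
  constructor
  · rintro ⟨x, hx0, hx⟩
    by_contra! hμ
    have hμ2 : μ + 2 ≠ 0 := fun h => hμ.1 (by linarith)
    have hr := congrFun hx r
    rw [distanceMatrix_starGraph_mulVec_center, Pi.smul_apply, smul_eq_mul] at hr
    -- The equation at a leaf determines its coordinate when `μ ≠ -2`, so an eigenvector is constant
    -- on the leaves.
    set t := (x r + 2 * ∑ w ∈ Finset.univ.erase r, x w) / (μ + 2) with ht
    have hxv : ∀ v ∈ Finset.univ.erase r, x v = t := by
      intro v hv
      have h := congrFun hx v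
      rw [distanceMatrix_starGraph_mulVec_of_ne (Finset.ne_of_mem_erase hv), Pi.smul_apply,
        smul_eq_mul] at h
      rw [ht, eq_div_iff hμ2]
      linarith
    rw [Finset.sum_congr rfl hxv, Finset.sum_const, nsmul_eq_mul, hcard] at hr ht
    rw [eq_div_iff hμ2] at ht
    have ht0 : t = 0 := by
      refine (mul_eq_zero.mp (?_ : (μ ^ 2 - 2 * (Fintype.card V - 2) * μ
        - (Fintype.card V - 1)) * t = 0)).resolve_left hμ.2
      linear_combination μ * ht - hr
    rw [ht0, zero_mul, mul_zero, mul_zero, add_zero] at ht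
    refine hx0 (funext fun v => ?_)
    by_cases hv : v = r
    · rw [hv, ← ht]; rfl
    · rw [hxv v (by simp [hv]), ht0]; rfl
  · rintro (rfl | hμ)
    · have h2 : 1 < (Finset.univ.erase r).card := by
        rw [Finset.card_erase_of_mem (Finset.mem_univ r), Finset.card_univ]; omega
      obtain ⟨p, hp, q, hq, hpq⟩ := Finset.one_lt_card.mp h2
      have hpr := (Finset.ne_of_mem_erase hp).symm
      have hqr := (Finset.ne_of_mem_erase hq).symm
      -- A difference of two leaves is an eigenvector for `-2`; this is where three vertices are
      -- needed.
      set x : V → ℝ := Pi.single p 1 - Pi.single q 1 with hx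
      have hsum : ∑ w ∈ Finset.univ.erase r, x w = 0 := by
        simp [hx, hp, hq]
      have hxr : x r = 0 := by simp [hx, hpr, hqr]
      refine ⟨x, fun h => ?_, funext fun v => ?_⟩
      · have := congrFun h p
        simp [hx, hpq] at this
      · rw [Pi.smul_apply, smul_eq_mul]
        by_cases hv : v = r
        · rw [hv, distanceMatrix_starGraph_mulVec_center, hsum, hxr, mul_zero]
        · rw [distanceMatrix_starGraph_mulVec_of_ne hv, hsum, hxr]
          ring
    · have hμ0 : μ ≠ 0 := by
        rintro rfl
        linarith
      set x : V → ℝ := fun v => if v = r then Fintype.card V - 1 else μ with hx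
      have hsum : ∑ w ∈ Finset.univ.erase r, x w = (Fintype.card V - 1) * μ := by
        rw [Finset.sum_congr rfl (g := fun _ => μ)
          (fun w hw => by simp [hx, Finset.ne_of_mem_erase hw]), Finset.sum_const, nsmul_eq_mul,
          hcard]
      have hxr : x r = Fintype.card V - 1 := by simp [hx]
      refine ⟨x, fun h => ?_, funext fun v => ?_⟩
      · have := congrFun h r
        rw [hxr, Pi.zero_apply] at this
        linarith
      · rw [Pi.smul_apply, smul_eq_mul]
        by_cases hv : v = r
        · rw [hv, distanceMatrix_starGraph_mulVec_center, hsum, hxr, mul_comm]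
        · rw [distanceMatrix_starGraph_mulVec_of_ne hv, hsum, hxr, show x v = μ by simp [hx, hv]]
          linear_combination -hμ

theorem ncard_distanceEigenvalues_starGraph (hV : 3 ≤ Fintype.card V) (r : V) :
    (distanceEigenvalues (starGraph r)).ncard = 3 := by
  have hV' : (3 : ℝ) ≤ Fintype.card V := by exact_mod_cast hV
  -- The quadratic is `μ² - 2kμ - (k + 1)`, with roots `k ± √(k² + k + 1)`; neither is `-2`, since
  -- `k² + k + 1 < (k + 2)²`.
  set k : ℝ := Fintype.card V - 2 with hk
  have hpos : 0 < k ^ 2 + k + 1 := by nlinarith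
  have hsq := Real.sq_sqrt hpos.le
  have hspos := Real.sqrt_pos.mpr hpos
  set s := √(k ^ 2 + k + 1)
  rw [Set.ncard_eq_three]
  refine ⟨-2, k + s, k - s, ?_, ?_, ?_, ?_⟩
  · intro h
    nlinarith
  · intro h
    nlinarith
  · intro h
    linarith
  · ext μ
    rw [mem_distanceEigenvalues_starGraph_iff hV]
    simp only [Set.mem_insert_iff, Set.mem_singleton_iff]
    refine or_congr_right ?_
    have : μ ^ 2 - 2 * (Fintype.card V - 2) * μ - (Fintype.card V - 1)
        = (μ - (k + s)) * (μ - (k - s)) := by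
      rw [hk] at hsq ⊢
      linear_combination hsq
    rw [this, mul_eq_zero, sub_eq_zero, sub_eq_zero]

end SimpleGraph

theorem theorem1p4 {V : Type*} [Fintype V] [DecidableEq V] (T : SimpleGraph V) (hT : T.IsTree) :
    (distanceEigenvalues T).ncard = 3 ↔ (3 ≤ Fintype.card V ∧ IsStar T) := by
  classical
  refine ⟨hT.isStar_of_ncard_eq_three, ?_⟩
  rintro ⟨hV, r, rfl⟩
  exact SimpleGraph.ncard_distanceEigenvalues_starGraph hV r
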